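/- Let $U,T,U',T'$ be $\sigma$-finite measure spaces (receiving users, receive times, transmitting users, transmit times; for instance intervals with Lebesgue measure, or finite sets with counting measure), and let $k_H(u,t;u',t')$ be a complex-valued square-integrable kernel on $(U\times T)\times(U'\times T')$, with channel operator $$(Hx)(u,t)=\iint k_H(u,t;u',t')\,x(u',t')\,du'\,dt',\qquad x\in L^2(U'\times T').$$ Write $\langle a,b\rangle=\iint a\,b^*\,du\,dt$ and $\|a\|^2=\langle a,a\rangle$. A decomposition of $k_H$ consists of a finite or countably infinite index set, nonzero numbers $\sigma_n\in\mathbb C$ and orthonormal families $\{\psi_n\}\subset L^2(U\times T)$, $\{\phi_n\}\subset L^2(U'\times T')$ such that $$k_H(u,t;u',t')=\sum_n\sigma_n\,\psi_n(u,t)\,\phi_n(u',t')\quad\text{in }L^2 .$$ Then $k_H$ has such a decomposition, and for every such decomposition and every data signal $s\in L^2(U\times T)$, with $x_n=\langle s,\psi_n\rangle/\sigma_n$, the following hold. 1. If $s$ lies in the closed linear span of $\{\psi_n\}$ (for instance if $\{\psi_n\}$ is an orthonormal basis) and the series $x(u',t')=\sum_n x_n\,\phi_n^*(u',t')$ converges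 in $L^2(U'\times T')$, then the integral $(Hx)(u,t)$ converges absolutely for almost every $(u,t)$, and the precoded signal $x$ gives interference-free reception: $\|s-Hx\|^2=0$. 2. There is some $y\in L^2(U'\times T')$ with $\|s-Hy\|^2=0$ if and only if $s$ lies in the closed linear span of $\{\psi_n\}$ and the series $\sum_n x_n\phi_n^*$ converges in $L^2(U'\times T')$. 3. If $s$ lies in the closed linear span of $\{\psi_n\}$, then, whether or not that series converges, its partial sums (over finite sets $F$ of indices, ordered by inclusion) satisfy $\bigl\|s-H\sum_{n\in F}x_n\phi_n^*\bigr\|^2\to0$. -/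

import Mathlib

open MeasureTheory Filter Topology
open scoped ENNReal ComplexConjugate

noncomputable section

namespace Precoding

/-- The inner product `⟨a, b⟩ = ∫ a b^*`. -/
def ip {X : Type*} [MeasurableSpace X] (μ : Measure X) (a b : X → ℂ) : ℂ :=
  ∫ p, a p * conj (b p) ∂μ

/-- The squared norm `‖f‖² = ∫ |f|²`, with values in `[0, ∞]`. -/
def sqNorm {X : Type*} [MeasurableSpace X] (μ : Measure X) (f : X → ℂ) : ℝ≥0∞ :=
  ∫⁻ p, ‖f p‖ₑ ^ 2 ∂μ

/-- The series `∑ n, f n` converges (unconditionally) to `g` in the `L²` sense. -/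
def HasSumL2 {X ι : Type*} [MeasurableSpace X] (μ : Measure X) (f : ι → X → ℂ) (g : X → ℂ) :
    Prop :=
  Tendsto (fun F : Finset ι => sqNorm μ (fun p => g p - ∑ n ∈ F, f n p)) atTop (𝓝 0)

/-- `f` lies in the `L²`-closed linear span of the family `e`. -/
def InClosedSpan {X ι : Type*} [MeasurableSpace X] (μ : Measure X) (e : ι → X → ℂ)
    (f : X → ℂ) : Prop :=
  ∀ ε : ℝ≥0∞, 0 < ε →
    ∃ (F : Finset ι) (c : ι → ℂ), sqNorm μ (fun p => f p - ∑ n ∈ F, c n * e n p) < ε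

/-- `e` is an orthonormal family of square-integrable functions. -/
structure IsOrthonormal {X ι : Type*} [MeasurableSpace X] (μ : Measure X) (e : ι → X → ℂ) :
    Prop where
  memLp : ∀ n, MemLp (e n) 2 μ
  norm_one : ∀ n, ip μ (e n) (e n) = 1
  orthogonal : ∀ n m, n ≠ m → ip μ (e n) (e m) = 0

/-- The channel with kernel `k`: `(H x)(p) = ∫ k(p; q) x(q) dq`. -/
def channel {X Y : Type*} [MeasurableSpace Y] (ν : Measure Y) (k : X → Y → ℂ) (x : Y → ℂ) :
    X → ℂ :=
  fun p => ∫ q, k p q * x q ∂ν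

/-- `k(p; q) = ∑ n, σ n ψ n(p) φ n(q)` in `L²` of the product, with nonzero `σ n` and with
orthonormal families `ψ` and `φ`. -/
structure IsDecomposition {X Y ι : Type*} [MeasurableSpace X] [MeasurableSpace Y]
    (μ : Measure X) (ν : Measure Y) (k : X → Y → ℂ)
    (σ : ι → ℂ) (ψ : ι → X → ℂ) (φ : ι → Y → ℂ) : Prop where
  ne_zero : ∀ n, σ n ≠ 0
  orthonormal_out : IsOrthonormal μ ψ
  orthonormal_in : IsOrthonormal ν φ
  hasSum : HasSumL2 (μ.prod ν) (fun n (z : X × Y) => σ n * ψ n z.1 * φ n z.2)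
    (fun z => k z.1 z.2)

/-- The `n`-th term `x n φ n^*` of the precoded signal, where `x n = ⟨s, ψ n⟩ / σ n`. -/
def precodedTerm {X Y ι : Type*} [MeasurableSpace X] (μ : Measure X)
    (σ : ι → ℂ) (ψ : ι → X → ℂ) (φ : ι → Y → ℂ) (s : X → ℂ) (n : ι) : Y → ℂ :=
  fun q => ip μ s (ψ n) / σ n * conj (φ n q)

/-- `x` is square-integrable and `x = ∑ n, (⟨s, ψ n⟩ / σ n) φ n^*` in `L²`. -/
structure IsPrecoded {X Y ι : Type*} [MeasurableSpace X] [MeasurableSpace Y]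
    (μ : Measure X) (ν : Measure Y)
    (σ : ι → ℂ) (ψ : ι → X → ℂ) (φ : ι → Y → ℂ) (s : X → ℂ) (x : Y → ℂ) : Prop where
  memLp : MemLp x 2 ν
  hasSum : HasSumL2 ν (precodedTerm μ σ ψ φ s) x

end Precoding

end

/-! A square-integrable kernel is a vector `K` of `L²(μ × ν)`, and its operator is determined by the
pairing ⟪a, Kx⟫ = ⟪a ⊗ x^*, K⟫ (`inner_kernelOp`). Product kernels have dense span, so the operator
determines the kernel and is compact. Existence: take singular vectors `e i` of the operator and
normalised images `f i`. The tensors f_i ⊗ e_i^* are orthonormal and `K` has coefficients σ_i along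
them, so Bessel gives a convergent sum `K'`. The operators of `K` and `K'` agree on every `e i` and
both vanish orthogonally to them, hence `K = K'`. Precoding: any decomposition gives Hx = ∑ σ_n
⟪φ_n^*, x⟫ ψ_n. Thus the range lies in the closed span of the ψ_n, and solving Hx = s means dividing
the n-th coefficient of s by σ_n. Convergence of the resulting series is the only further
obstruction to an exact solution; finite partial sums always map to partial sums of the expansion of
s. -/

section HilbertSpace

/-! ### Singular vectors and orthonormal expansions in Hilbert spaces -/

open scoped InnerProductSpace

variable {E F : Type*} [NormedAddCommGroup E] [InnerProductSpace ℂ E]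
  [NormedAddCommGroup F] [InnerProductSpace ℂ F]

/-- A compact operator between Hilbert spaces has an orthonormal family of right singular vectors
with nonzero singular values whose orthogonal complement lies in the kernel. -/
theorem IsCompactOperator.exists_orthonormal_singularVectors [CompleteSpace E]
    [CompleteSpace F] (A : E →L[ℂ] F)
    (hA : IsCompactOperator A) :
    ∃ (ι : Type) (e : ι → E), Orthonormal ℂ e ∧ (∀ i, A (e i) ≠ 0) ∧
      (∀ i j, i ≠ j → ⟪A (e i), A (e j)⟫_ℂ = 0) ∧
      ∀ x, (∀ i, ⟪e i, x⟫_ℂ = 0) → A x = 0 := by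
  -- Right singular vectors of `A` are the eigenvectors of A*A with nonzero eigenvalue; compactness
  -- makes those eigenspaces finite-dimensional.
  set S : E →L[ℂ] E := A.adjoint ∘L A with hS
  have hSc : IsCompactOperator S := hA.clm_comp A.adjoint
  have hinner : ∀ x y, ⟪A x, A y⟫_ℂ = ⟪x, S y⟫_ℂ := fun x y => by
    simp [hS, ContinuousLinearMap.adjoint_inner_right]
  have hSs : S.IsSymmetric := fun x y => by
    change ⟪S x, y⟫_ℂ = ⟪x, S y⟫_ℂ
    simp [hS, ContinuousLinearMap.adjoint_inner_right, ContinuousLinearMap.adjoint_inner_left]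
  have hfin : ∀ m : {m : ℂ // m ≠ 0},
      FiniteDimensional ℂ (Module.End.eigenspace (S : E →ₗ[ℂ] E) m) := fun m =>
    ContinuousLinearMap.finite_dimensional_eigenspace hSc m m.2
  let b := fun m : {m : ℂ // m ≠ 0} =>
    stdOrthonormalBasis ℂ (Module.End.eigenspace (S : E →ₗ[ℂ] E) m)
  let e : (Σ m : {m : ℂ // m ≠ 0},
      Fin (Module.finrank ℂ (Module.End.eigenspace (S : E →ₗ[ℂ] E) m))) → E :=
    fun i => (b i.1 i.2 : E)
  have he : Orthonormal ℂ e :=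
    (hSs.orthogonalFamily_eigenspaces.comp Subtype.val_injective).orthonormal_sigma_orthonormal
      (fun m => (b m).orthonormal)
  have hSe : ∀ i, S (e i) = (i.1 : ℂ) • e i := fun i =>
    Module.End.mem_eigenspace_iff.1 (b i.1 i.2).2
  refine ⟨_, e, he, fun i h0 => ?_, fun i j hij => ?_, fun x hx => ?_⟩
  · have h := hinner (e i) (e i)
    rw [h0, hSe, inner_smul_right, inner_zero_left, inner_self_eq_norm_sq_to_K, he.1 i] at h
    exact i.1.2 (by simpa using h.symm)
  · rw [hinner, hSe, inner_smul_right, he.2 hij, mul_zero]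
  · have hxm : ∀ m : ℂ, m ≠ 0 → ∀ v ∈ Module.End.eigenspace (S : E →ₗ[ℂ] E) m,
        ⟪v, x⟫_ℂ = 0 := by
      intro m hm v hv
      have h := (b ⟨m, hm⟩).sum_repr ⟨v, hv⟩
      have h' := congrArg (Subtype.val) h
      rw [Submodule.coe_sum] at h'
      change _ = v at h'
      rw [← h', sum_inner]
      refine Finset.sum_eq_zero fun j _ => ?_
      rw [Submodule.coe_smul, inner_smul_left]
      exact mul_eq_zero_of_right _ (hx ⟨⟨m, hm⟩, j⟩)
    have hSx : S x = 0 := by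
      -- `S x` is orthogonal to every eigenspace: for m = 0 because `S` is symmetric, otherwise
      -- because `x` itself is. The spectral theorem then forces `S x = 0`, and ‖Ax‖² = ⟪x, Sx⟫
      -- finishes.
      have hmem : S x ∈ (⨆ m, Module.End.eigenspace (S : E →ₗ[ℂ] E) m)ᗮ := by
        rw [← Submodule.iInf_orthogonal, Submodule.mem_iInf]
        intro m v hv
        have h1 : ⟪v, S x⟫_ℂ = ⟪S v, x⟫_ℂ := (hSs v x).symm
        have h2 : S v = m • v := Module.End.mem_eigenspace_iff.1 hv
        rw [h1, h2, inner_smul_left]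
        by_cases hm : m = 0
        · simp [hm]
        · rw [hxm m hm v hv, mul_zero]
      rw [ContinuousLinearMap.orthogonalComplement_iSup_eigenspaces_eq_bot hSc hSs] at hmem
      simpa using hmem
    rw [← inner_self_eq_zero (𝕜 := ℂ), hinner, hSx, inner_zero_right]

theorem Orthonormal.summable_smul [CompleteSpace E] {ι : Type*} {v : ι → E}
    (hv : Orthonormal ℂ v) {c : ι → ℂ}
    (hc : Summable fun i => ‖c i‖ ^ 2) : Summable fun i => c i • v i := by
  have h := (hv.orthogonalFamily.summable_iff_norm_sq_summable c).2 hc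
  simpa using h

theorem Orthonormal.inner_right_hasSum_smul {ι : Type*} {v : ι → E} (hv : Orthonormal ℂ v)
    {c : ι → ℂ} {x : E} (hx : HasSum (fun i => c i • v i) x) (j : ι) : ⟪v j, x⟫_ℂ = c j := by
  classical
  have h := hx.mapL (innerSL ℂ (v j))
  simp only [innerSL_apply_apply, inner_smul_right, orthonormal_iff_ite.1 hv, mul_ite, mul_one,
    mul_zero] at h
  have h' : HasSum (fun i => if j = i then c i else 0) (c j) := by
    simpa using hasSum_single (f := fun i => if j = i then c i else 0) j
      fun i hi => if_neg (Ne.symm hi)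
  exact h.unique h'

theorem Orthonormal.summable_inner_smul [CompleteSpace E] {ι : Type*} {v : ι → E}
    (hv : Orthonormal ℂ v) (x : E) :
    Summable fun i => ⟪v i, x⟫_ℂ • v i :=
  hv.summable_smul (hv.inner_products_summable x)

theorem HasSum.mem_topologicalClosure_span {ι : Type*} {v : ι → E} {c : ι → ℂ} {x : E}
    (hx : HasSum (fun i => c i • v i) x) :
    x ∈ (Submodule.span ℂ (Set.range v)).topologicalClosure :=
  mem_closure_of_tendsto hx (Eventually.of_forall fun _ =>
    Submodule.sum_mem _ fun i _ => Submodule.smul_mem _ _ (Submodule.subset_span ⟨i, rfl⟩))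

/-- Bessel's inequality makes the expansion converge to some `y`; the difference `x - y` lies in the
closed span and is orthogonal to it. -/
theorem Orthonormal.hasSum_inner_smul [CompleteSpace E] {ι : Type*} {v : ι → E}
    (hv : Orthonormal ℂ v) {x : E}
    (hx : x ∈ (Submodule.span ℂ (Set.range v)).topologicalClosure) :
    HasSum (fun i => ⟪v i, x⟫_ℂ • v i) x := by
  obtain ⟨y, hy⟩ := hv.summable_inner_smul x
  have hxy : x - y ∈ (Submodule.span ℂ (Set.range v)).topologicalClosure :=
    Submodule.sub_mem _ hx hy.mem_topologicalClosure_span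
  have hxy' : x - y ∈ (Submodule.span ℂ (Set.range v)).topologicalClosureᗮ := by
    rw [Submodule.orthogonal_closure, Submodule.mem_orthogonal]
    intro u hu
    induction hu using Submodule.span_induction with
    | mem u hu =>
      obtain ⟨i, rfl⟩ := hu
      rw [inner_sub_right, hv.inner_right_hasSum_smul hy i, sub_self]
    | zero => simp
    | add u w _ _ h1 h2 => rw [inner_add_left, h1, h2, add_zero]
    | smul c u _ h => rw [inner_smul_left, h, mul_zero]
  have h0 : x - y = 0 := by
    rw [← inner_self_eq_zero (𝕜 := ℂ)]
    exact hxy' _ hxy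
  exact (sub_eq_zero.1 h0) ▸ hy

theorem isCompactOperator_inner_smul (a : F) (b : E) :
    IsCompactOperator fun x : E => ⟪b, x⟫_ℂ • a :=
  (isCompactOperator_of_locallyCompactSpace_rng
    (ContinuousLinearMap.toSpanSingleton ℂ a)).comp_clm (innerSL ℂ b)

/-- The agreement locus is a closed subspace containing each `v i`. A vector orthogonal to it is
orthogonal to every `v i`, hence lies in it by `h'`, hence is zero. -/
theorem ContinuousLinearMap.ext_of_forall_orthogonal [CompleteSpace E] {ι : Type*} {v : ι → E}
    {A B : E →L[ℂ] F} (h : ∀ i, A (v i) = B (v i))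
    (h' : ∀ x, (∀ i, ⟪v i, x⟫_ℂ = 0) → A x = B x) : A = B := by
  have hcomplete : CompleteSpace (A.eqLocus B) :=
    (isClosed_eq A.continuous B.continuous).completeSpace_coe
  have htop : A.eqLocus B = ⊤ := by
    rw [← Submodule.orthogonal_eq_bot_iff, Submodule.eq_bot_iff]
    intro x hx
    exact inner_self_eq_zero.1 (hx x (h' x fun i => hx _ (h i)))
  ext1 x
  have hx : x ∈ A.eqLocus B := htop ▸ Submodule.mem_top
  exact hx

end HilbertSpace

namespace Precoding

open scoped InnerProductSpace

/-! ### Translation between functions and classes in `Lp` -/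

section L2

variable {X ι : Type*} [MeasurableSpace X] {μ : Measure X}

theorem sqNorm_eq_eLpNorm_sq (f : X → ℂ) : sqNorm μ f = eLpNorm f 2 μ ^ 2 := by
  have h := eLpNorm_nnreal_pow_eq_lintegral (f := f) (μ := μ) (p := 2) two_ne_zero
  simpa [sqNorm] using h.symm

theorem sqNorm_congr_ae {f g : X → ℂ} (h : f =ᵐ[μ] g) : sqNorm μ f = sqNorm μ g := by
  simp only [sqNorm_eq_eLpNorm_sq, eLpNorm_congr_ae h]

theorem sqNorm_coeFn (f : Lp ℂ 2 μ) : sqNorm μ f = ‖f‖ₑ ^ 2 := by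
  rw [sqNorm_eq_eLpNorm_sq, Lp.enorm_def]

theorem tendsto_enorm_sq_zero_iff {α E : Type*} [SeminormedAddCommGroup E] {l : Filter α}
    {u : α → E} : Tendsto (fun a => ‖u a‖ₑ ^ 2) l (𝓝 0) ↔ Tendsto u l (𝓝 0) := by
  have h1 : Tendsto u l (𝓝 0) ↔ Tendsto (fun a => ‖u a‖ₑ) l (𝓝 0) := by
    simp [tendsto_iff_edist_tendsto_0]
  rw [h1]
  refine ⟨fun h => ?_, fun h => ?_⟩
  · have h2 := (ENNReal.continuous_rpow_const (y := 1 / 2)).tendsto 0 |>.comp h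
    have h3 : ((fun a : ℝ≥0∞ => a ^ (1 / 2 : ℝ)) ∘ fun a => ‖u a‖ₑ ^ 2) = fun a => ‖u a‖ₑ := by
      ext a
      rw [Function.comp_apply, ← ENNReal.rpow_natCast, ← ENNReal.rpow_mul]
      norm_num
    rw [h3] at h2
    simpa using h2
  · simpa [Function.comp_def] using ((ENNReal.continuous_pow 2).tendsto 0).comp h

theorem ip_eq_inner {a b : X → ℂ} (ha : MemLp a 2 μ) (hb : MemLp b 2 μ) :
    ip μ a b = ⟪hb.toLp b, ha.toLp a⟫_ℂ := by
  rw [L2.inner_def]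
  refine integral_congr_ae ?_
  filter_upwards [ha.coeFn_toLp, hb.coeFn_toLp] with p h1 h2
  rw [h1, h2, RCLike.inner_apply]

theorem _root_.MeasureTheory.MemLp.conj {f : X → ℂ} (hf : MemLp f 2 μ) :
    MemLp (fun p => conj (f p)) 2 μ :=
  hf.star

theorem coeFn_sub_sum {f : ι → X → ℂ} {g : X → ℂ} (hf : ∀ n, MemLp (f n) 2 μ)
    (hg : MemLp g 2 μ) (F : Finset ι) :
    (hg.toLp g - ∑ n ∈ F, (hf n).toLp (f n) : Lp ℂ 2 μ) =ᵐ[μ]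
      fun p => g p - ∑ n ∈ F, f n p := by
  have h : ∀ᵐ p ∂μ, ∀ n ∈ F, (hf n).toLp (f n) p = f n p :=
    (F.eventually_all).2 fun n _ => (hf n).coeFn_toLp
  filter_upwards [Lp.coeFn_sub (hg.toLp g) (∑ n ∈ F, (hf n).toLp (f n)), hg.coeFn_toLp,
    Lp.coeFn_finsetSum F (fun n => (hf n).toLp (f n)), h] with p h1 h2 h3 h4
  rw [h1, Pi.sub_apply, h2, h3, Finset.sum_apply, Finset.sum_congr rfl h4]

theorem hasSumL2_iff {f : ι → X → ℂ} {g : X → ℂ} (hf : ∀ n, MemLp (f n) 2 μ)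
    (hg : MemLp g 2 μ) :
    HasSumL2 μ f g ↔ HasSum (fun n => (hf n).toLp (f n)) (hg.toLp g) := by
  have h : (fun F : Finset ι => sqNorm μ fun p => g p - ∑ n ∈ F, f n p) =
      fun F => ‖hg.toLp g - ∑ n ∈ F, (hf n).toLp (f n)‖ₑ ^ 2 := by
    ext F
    rw [← sqNorm_coeFn, sqNorm_congr_ae (coeFn_sub_sum hf hg F)]
  rw [HasSumL2, h, tendsto_enorm_sq_zero_iff, HasSum, SummationFilter.unconditional_filter]
  refine ⟨fun h => ?_, fun h => ?_⟩
  · simpa using h.const_sub (hg.toLp g)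
  · simpa using h.const_sub (hg.toLp g)

theorem orthonormal_toLp {e : ι → X → ℂ} (he : IsOrthonormal μ e) :
    Orthonormal ℂ fun n => (he.memLp n).toLp (e n) := by
  classical
  rw [orthonormal_iff_ite]
  intro i j
  rw [← ip_eq_inner (he.memLp j) (he.memLp i)]
  split_ifs with h
  · rw [h, he.norm_one]
  · exact he.orthogonal _ _ (Ne.symm h)

theorem isOrthonormal_coeFn {e : ι → Lp ℂ 2 μ} (he : Orthonormal ℂ e) :
    IsOrthonormal μ fun n => (e n : X → ℂ) := by
  classical
  have h : ∀ n m, ip μ (e n) (e m) = if m = n then 1 else 0 := fun n m => by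
    rw [ip_eq_inner (Lp.memLp (e n)) (Lp.memLp (e m)), Lp.toLp_coeFn, Lp.toLp_coeFn,
      orthonormal_iff_ite.1 he]
  exact ⟨fun n => Lp.memLp _, fun n => by simp [h], fun n m hnm => by simp [h, hnm.symm]⟩

theorem IsOrthonormal.conj {e : ι → X → ℂ} (he : IsOrthonormal μ e) :
    IsOrthonormal μ fun n p => conj (e n p) := by
  have h : ∀ n m, ip μ (fun p => conj (e n p)) (fun p => conj (e m p)) = ip μ (e m) (e n) :=
    fun n m => by simp [ip, mul_comm]
  exact ⟨fun n => (he.memLp n).conj, fun n => by rw [h, he.norm_one],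
    fun n m hnm => by rw [h, he.orthogonal _ _ hnm.symm]⟩

theorem inClosedSpan_iff {e : ι → X → ℂ} {f : X → ℂ} (he : ∀ n, MemLp (e n) 2 μ)
    (hf : MemLp f 2 μ) :
    InClosedSpan μ e f ↔ hf.toLp f ∈
      (Submodule.span ℂ (Set.range fun n => (he n).toLp (e n))).topologicalClosure := by
  have hsq : ∀ (F : Finset ι) (c : ι → ℂ), sqNorm μ (fun p => f p - ∑ n ∈ F, c n * e n p) =
      edist (hf.toLp f) (∑ n ∈ F, c n • (he n).toLp (e n)) ^ 2 := fun F c => by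
    have h := coeFn_sub_sum (fun n => (he n).const_smul (c n)) hf F
    rw [edist_eq_enorm_sub, ← sqNorm_coeFn]
    exact (sqNorm_congr_ae h).symm
  change _ ↔ _ ∈ closure _
  rw [EMetric.mem_closure_iff]
  constructor
  · intro h ε hε
    obtain ⟨F, c, hFc⟩ := h (ε ^ 2) (by positivity)
    rw [hsq] at hFc
    refine ⟨_, ?_, (ENNReal.pow_lt_pow_left_iff two_ne_zero).1 hFc⟩
    exact Submodule.sum_mem _ fun i _ => Submodule.smul_mem _ _ (Submodule.subset_span ⟨i, rfl⟩)
  · intro h ε hε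
    -- The square root appears because `sqNorm` is a squared distance.
    obtain ⟨y, hy, hlt⟩ := h (ε ^ (1 / 2 : ℝ)) (ENNReal.rpow_pos_of_nonneg hε (by norm_num))
    obtain ⟨c, rfl⟩ := (Finsupp.mem_span_range_iff_exists_finsupp).1 hy
    refine ⟨c.support, c, ?_⟩
    rw [hsq]
    have h2 : (ε ^ (1 / 2 : ℝ)) ^ 2 = ε := by
      rw [← ENNReal.rpow_natCast, ← ENNReal.rpow_mul]
      norm_num
    rw [← h2]
    exact (ENNReal.pow_lt_pow_left_iff two_ne_zero).2 hlt

end L2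

/-! ### The bounded operator of a square-integrable kernel -/

section Channel

variable {X Y : Type*} [MeasurableSpace X] [MeasurableSpace Y] {μ : Measure X} {ν : Measure Y}

theorem channel_congr_ae [SFinite ν] {k k' : X → Y → ℂ} {x x' : Y → ℂ}
    (hk : (fun z : X × Y => k z.1 z.2) =ᵐ[μ.prod ν] fun z => k' z.1 z.2) (hx : x =ᵐ[ν] x') :
    channel ν k x =ᵐ[μ] channel ν k' x' := by
  filter_upwards [Measure.ae_ae_of_ae_prod hk] with p hp
  refine integral_congr_ae ?_
  filter_upwards [hp, hx] with q h1 h2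
  rw [h2]
  exact congrArg (· * x' q) h1

theorem memLp_mul_conj {a : X → ℂ} {b : Y → ℂ} (ha : MemLp a 2 μ) (hb : MemLp b 2 ν) :
    MemLp (fun z : X × Y => a z.1 * conj (b z.2)) 2 (μ.prod ν) := by
  have hm : AEStronglyMeasurable (fun z : X × Y => a z.1 * conj (b z.2)) (μ.prod ν) :=
    ha.1.comp_fst.mul hb.conj.1.comp_snd
  rw [memLp_two_iff_integrable_sq_norm hm]
  have h := ((memLp_two_iff_integrable_sq_norm ha.1).1 ha).mul_prod
    ((memLp_two_iff_integrable_sq_norm hb.1).1 hb)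
  simpa [mul_pow] using h

/-- The kernel `a(p) b(q)^*`. -/
noncomputable def tensor (a : Lp ℂ 2 μ) (b : Lp ℂ 2 ν) : Lp ℂ 2 (μ.prod ν) :=
  (memLp_mul_conj (Lp.memLp a) (Lp.memLp b)).toLp _

theorem tensor_toLp {a : X → ℂ} {b : Y → ℂ} (ha : MemLp a 2 μ) (hb : MemLp b 2 ν) :
    tensor (ha.toLp a) (hb.toLp b) = (memLp_mul_conj ha hb).toLp _ := by
  rw [tensor, MemLp.toLp_eq_toLp_iff]
  filter_upwards [Measure.quasiMeasurePreserving_fst.ae ha.coeFn_toLp,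
    Measure.quasiMeasurePreserving_snd.ae hb.coeFn_toLp] with z h1 h2
  rw [h1, h2]

theorem tensor_add_right (a : Lp ℂ 2 μ) (b b' : Lp ℂ 2 ν) :
    tensor a (b + b') = tensor a b + tensor a b' := by
  rw [tensor, tensor, tensor, ← MemLp.toLp_add, MemLp.toLp_eq_toLp_iff]
  filter_upwards [Measure.quasiMeasurePreserving_snd.ae (Lp.coeFn_add b b')] with z h
  rw [h]
  simp only [Pi.add_apply, map_add, mul_add]

theorem tensor_smul_right (c : ℂ) (a : Lp ℂ 2 μ) (b : Lp ℂ 2 ν) :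
    tensor a (c • b) = conj c • tensor a b := by
  rw [tensor, tensor, ← MemLp.toLp_const_smul, MemLp.toLp_eq_toLp_iff]
  filter_upwards [Measure.quasiMeasurePreserving_snd.ae (Lp.coeFn_smul c b)] with z h
  rw [h]
  simp only [Pi.smul_apply, smul_eq_mul, map_mul, mul_left_comm]

variable [SFinite μ] [SFinite ν]

theorem ae_memLp_kernel {k : X → Y → ℂ} (hk : MemLp (fun z : X × Y => k z.1 z.2) 2 (μ.prod ν)) :
    ∀ᵐ p ∂μ, MemLp (k p) 2 ν := by
  have h := (memLp_two_iff_integrable_sq_norm hk.1).1 hk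
  filter_upwards [hk.1.prodMk_left, h.prod_right_ae] with p h1 h2
  exact (memLp_two_iff_integrable_sq_norm h1).2 h2

theorem ae_integrable_kernel_mul {k : X → Y → ℂ} {x : Y → ℂ}
    (hk : MemLp (fun z : X × Y => k z.1 z.2) 2 (μ.prod ν)) (hx : MemLp x 2 ν) :
    ∀ᵐ p ∂μ, Integrable (fun q => k p q * x q) ν := by
  filter_upwards [ae_memLp_kernel hk] with p hp
  exact hp.integrable_mul hx

/-- Cauchy–Schwarz in `q` for almost every `p`, then Tonelli: the Hilbert–Schmidt bound. -/
theorem sqNorm_channel_le {k : X → Y → ℂ} {x : Y → ℂ}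
    (hk : MemLp (fun z : X × Y => k z.1 z.2) 2 (μ.prod ν)) (hx : MemLp x 2 ν) :
    sqNorm μ (channel ν k x) ≤ sqNorm (μ.prod ν) (fun z => k z.1 z.2) * sqNorm ν x := by
  have hm : AEMeasurable (fun z : X × Y => ‖k z.1 z.2‖ₑ ^ 2) (μ.prod ν) :=
    hk.1.enorm.pow_const 2
  have hpt : ∀ᵐ p ∂μ, ‖channel ν k x p‖ₑ ^ 2 ≤ (∫⁻ q, ‖k p q‖ₑ ^ 2 ∂ν) * sqNorm ν x := by
    filter_upwards [ae_memLp_kernel hk] with p hp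
    have h1 : ‖channel ν k x p‖ₑ ≤ eLpNorm (k p) 2 ν * eLpNorm x 2 ν := by
      refine (enorm_integral_le_lintegral_enorm _).trans ?_
      have h2 := eLpNorm_smul_le_mul_eLpNorm (r := 1) (p := 2) (q := 2) hx.1 hp.1
      rwa [eLpNorm_one_eq_lintegral_enorm] at h2
    have h3 : ∫⁻ q, ‖k p q‖ₑ ^ 2 ∂ν = eLpNorm (k p) 2 ν ^ 2 := sqNorm_eq_eLpNorm_sq (k p)
    rw [h3, sqNorm_eq_eLpNorm_sq, ← mul_pow]
    gcongr
  refine (lintegral_mono_ae hpt).trans ?_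
  rw [lintegral_mul_const'' _ hm.lintegral_prod_right', sqNorm.eq_1 (μ.prod ν),
    lintegral_prod _ hm]

theorem memLp_channel {k : X → Y → ℂ} {x : Y → ℂ}
    (hk : MemLp (fun z : X × Y => k z.1 z.2) 2 (μ.prod ν)) (hx : MemLp x 2 ν) :
    MemLp (channel ν k x) 2 μ := by
  refine ⟨(hk.1.mul hx.1.comp_snd).integral_prod_right', ?_⟩
  have h : eLpNorm (channel ν k x) 2 μ ^ 2 < ∞ := by
    rw [← sqNorm_eq_eLpNorm_sq]
    refine (sqNorm_channel_le hk hx).trans_lt ?_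
    rw [sqNorm_eq_eLpNorm_sq, sqNorm_eq_eLpNorm_sq]
    exact ENNReal.mul_lt_top (ENNReal.pow_lt_top hk.2) (ENNReal.pow_lt_top hx.2)
  exact (ENNReal.pow_lt_top_iff.1 h).resolve_right two_ne_zero

theorem inner_tensor_tensor (a a' : Lp ℂ 2 μ) (b b' : Lp ℂ 2 ν) :
    ⟪tensor a b, tensor a' b'⟫_ℂ = ⟪a, a'⟫_ℂ * ⟪b', b⟫_ℂ := by
  rw [tensor, tensor, ← ip_eq_inner, L2.inner_def, L2.inner_def, ← integral_prod_mul]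
  refine integral_congr_ae (Eventually.of_forall fun z => ?_)
  simp only [RCLike.inner_apply, map_mul, Complex.conj_conj]
  ring

/-- Fubini. This pairing reduces the bilinearity of `kernelOp` to identities between inner products,
with no almost-everywhere argument about `channel`. -/
theorem inner_toLp_channel {k : X → Y → ℂ}
    (hk : MemLp (fun z : X × Y => k z.1 z.2) 2 (μ.prod ν)) (a : Lp ℂ 2 μ) (x : Lp ℂ 2 ν) :
    ⟪a, (memLp_channel hk (Lp.memLp x)).toLp _⟫_ℂ = ⟪tensor a x, hk.toLp _⟫_ℂ := by
  have ha := Lp.toLp_coeFn a (Lp.memLp a)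
  have h1 : ⟪a, (memLp_channel hk (Lp.memLp x)).toLp _⟫_ℂ = ip μ (channel ν k x) a := by
    rw [ip_eq_inner (memLp_channel hk (Lp.memLp x)) (Lp.memLp a), ha]
  have hint : Integrable (fun z : X × Y => k z.1 z.2 * conj (a z.1 * conj (x z.2)))
      (μ.prod ν) := hk.integrable_mul (memLp_mul_conj (Lp.memLp a) (Lp.memLp x)).conj
  rw [h1, tensor, ← ip_eq_inner, ip, ip, integral_prod _ hint]
  refine integral_congr_ae (Eventually.of_forall fun p => ?_)
  simp only [channel, ← integral_mul_const, map_mul, Complex.conj_conj]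
  refine integral_congr_ae (Eventually.of_forall fun q => ?_)
  simp only
  ring

theorem memLp_channel_coeFn (K : Lp ℂ 2 (μ.prod ν)) (x : Lp ℂ 2 ν) :
    MemLp (channel ν (fun p q => K (p, q)) x) 2 μ :=
  memLp_channel (k := fun p q => K (p, q)) (Lp.memLp K) (Lp.memLp x)

theorem inner_toLp_channel_coeFn (K : Lp ℂ 2 (μ.prod ν)) (a : Lp ℂ 2 μ) (x : Lp ℂ 2 ν) :
    ⟪a, (memLp_channel_coeFn K x).toLp _⟫_ℂ = ⟪tensor a x, K⟫_ℂ := by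
  have h := inner_toLp_channel (k := fun p q => K (p, q)) (Lp.memLp K) a x
  have hK : (Lp.memLp K).toLp (fun z : X × Y => K (z.1, z.2)) = K := Lp.toLp_coeFn K (Lp.memLp K)
  rwa [hK] at h

theorem norm_toLp_channel_le (K : Lp ℂ 2 (μ.prod ν)) (x : Lp ℂ 2 ν) :
    ‖(memLp_channel_coeFn K x).toLp _‖ ≤ 1 * ‖K‖ * ‖x‖ := by
  have h := sqNorm_channel_le (k := fun p q => K (p, q)) (Lp.memLp K) (Lp.memLp x)
  have hK : sqNorm (μ.prod ν) (fun z => K (z.1, z.2)) = ‖K‖ₑ ^ 2 := sqNorm_coeFn K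
  rw [hK, sqNorm_coeFn, ← mul_pow, sqNorm_eq_eLpNorm_sq,
    ← Lp.enorm_toLp (memLp_channel_coeFn K x), ENNReal.pow_le_pow_left_iff two_ne_zero] at h
  rw [one_mul]
  have h' := ENNReal.toReal_mono (by finiteness) h
  simpa using h'

/-- The operator `L²(ν) → L²(μ)` with a given kernel, as a bounded bilinear map. -/
noncomputable def kernelOp : Lp ℂ 2 (μ.prod ν) →L[ℂ] Lp ℂ 2 ν →L[ℂ] Lp ℂ 2 μ :=
  LinearMap.mkContinuous₂
    (LinearMap.mk₂ ℂ (fun K x => (memLp_channel_coeFn K x).toLp _)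
      (fun K K' x => ext_inner_left ℂ fun a => by
        simp only [inner_add_right, inner_toLp_channel_coeFn])
      (fun c K x => ext_inner_left ℂ fun a => by
        simp only [inner_smul_right, inner_toLp_channel_coeFn])
      (fun K x x' => ext_inner_left ℂ fun a => by
        simp only [inner_add_right, inner_toLp_channel_coeFn, tensor_add_right, inner_add_left])
      (fun c K x => ext_inner_left ℂ fun a => by
        simp only [inner_smul_right, inner_toLp_channel_coeFn, tensor_smul_right,
          inner_smul_left, Complex.conj_conj]))
    1 norm_toLp_channel_le

theorem inner_kernelOp (K : Lp ℂ 2 (μ.prod ν)) (a : Lp ℂ 2 μ) (x : Lp ℂ 2 ν) :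
    ⟪a, kernelOp K x⟫_ℂ = ⟪tensor a x, K⟫_ℂ :=
  inner_toLp_channel_coeFn K a x

theorem kernelOp_toLp {k : X → Y → ℂ} {x : Y → ℂ}
    (hk : MemLp (fun z : X × Y => k z.1 z.2) 2 (μ.prod ν)) (hx : MemLp x 2 ν) :
    kernelOp (hk.toLp _) (hx.toLp x) = (memLp_channel hk hx).toLp _ :=
  (MemLp.toLp_eq_toLp_iff (memLp_channel_coeFn _ _) _).2
    (channel_congr_ae (k := fun p q => hk.toLp (fun z : X × Y => k z.1 z.2) (p, q))
      hk.coeFn_toLp hx.coeFn_toLp)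

/-- The conjugate built into `tensor` is what makes this the rank-one operator a⟪b, ·⟫. -/
theorem kernelOp_tensor (a : Lp ℂ 2 μ) (b x : Lp ℂ 2 ν) :
    kernelOp (tensor a b) x = ⟪b, x⟫_ℂ • a :=
  ext_inner_left ℂ fun c => by
    rw [inner_kernelOp, inner_tensor_tensor, inner_smul_right, mul_comm]

end Channel

/-! ### Density of product kernels, injectivity and compactness -/

section Density

variable {X Y : Type*} [MeasurableSpace X] [MeasurableSpace Y] {μ : Measure X} {ν : Measure Y}

/-- The indicator of a rectangle is the tensor of the indicators of its sides. -/
theorem setIntegral_prod_eq_zero [SFinite ν] {K : Lp ℂ 2 (μ.prod ν)}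
    (hK : ∀ a b, ⟪tensor a b, K⟫_ℂ = 0) {A : Set X} {B : Set Y} (hA : MeasurableSet A)
    (hB : MeasurableSet B) (hμA : μ A ≠ ∞) (hνB : ν B ≠ ∞) :
    ∫ z in A ×ˢ B, K z ∂(μ.prod ν) = 0 := by
  have hAB : (μ.prod ν) (A ×ˢ B) ≠ ∞ := by
    rw [Measure.prod_prod]
    exact ENNReal.mul_ne_top hμA hνB
  have h := hK (indicatorConstLp 2 hA hμA 1) (indicatorConstLp 2 hB hνB 1)
  rw [← L2.inner_indicatorConstLp_one (𝕜 := ℂ) (hA.prod hB) hAB K, ← h]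
  congr 1
  rw [indicatorConstLp, indicatorConstLp, indicatorConstLp, tensor_toLp,
    MemLp.toLp_eq_toLp_iff]
  refine Eventually.of_forall fun z => ?_
  by_cases h1 : z.1 ∈ A <;> by_cases h2 : z.2 ∈ B <;> simp [Set.indicator, h1, h2]

variable [SigmaFinite μ] [SigmaFinite ν]

/-- A kernel orthogonal to all product kernels vanishes. -/
theorem eq_zero_of_forall_inner_tensor_eq_zero {K : Lp ℂ 2 (μ.prod ν)}
    (hK : ∀ a b, ⟪tensor a b, K⟫_ℂ = 0) : K = 0 := by
  -- By σ-finiteness, countably many rectangles of finite measure cover the product. On each of them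
  -- `K` is integrable, and its integrals vanish first over rectangles, then over all measurable
  -- sets by the π-λ theorem.
  have hloc : ∀ n : ℕ × ℕ, ∀ᵐ z ∂(μ.prod ν).restrict
      (spanningSets μ n.1 ×ˢ spanningSets ν n.2), K z = 0 := by
    intro n
    set A := spanningSets μ n.1 with hA_def
    set B := spanningSets ν n.2 with hB_def
    have hA : MeasurableSet A := measurableSet_spanningSets μ n.1
    have hB : MeasurableSet B := measurableSet_spanningSets ν n.2
    have hμA : μ A < ∞ := measure_spanningSets_lt_top μ n.1
    have hνB : ν B < ∞ := measure_spanningSets_lt_top ν n.2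
    have hfin : IsFiniteMeasure ((μ.prod ν).restrict (A ×ˢ B)) := by
      refine isFiniteMeasure_restrict.2 ?_
      rw [Measure.prod_prod]
      exact ENNReal.mul_ne_top hμA.ne hνB.ne
    have hint : Integrable K ((μ.prod ν).restrict (A ×ˢ B)) :=
      ((Lp.memLp K).restrict _).integrable one_le_two
    have hrect : ∀ {S : Set X} {T : Set Y}, MeasurableSet S → MeasurableSet T →
        ∫ z in S ×ˢ T, K z ∂(μ.prod ν).restrict (A ×ˢ B) = 0 := by
      intro S T hS hT
      rw [Measure.restrict_restrict (hS.prod hT), Set.prod_inter_prod]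
      exact setIntegral_prod_eq_zero hK (hS.inter hA) (hT.inter hB)
        (measure_ne_top_of_subset Set.inter_subset_right hμA.ne)
        (measure_ne_top_of_subset Set.inter_subset_right hνB.ne)
    refine hint.ae_eq_zero_of_forall_setIntegral_eq_zero fun s hs _ => ?_
    induction s, hs using MeasurableSpace.induction_on_inter generateFrom_prod.symm
      isPiSystem_prod with
    | empty => simp
    | basic t ht =>
      obtain ⟨S, hS, T, hT, rfl⟩ := ht
      exact hrect hS hT
    | compl t ht ih =>
      have h := integral_add_compl ht hint
      have huniv := hrect (S := Set.univ) (T := Set.univ) .univ .univ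
      rw [Set.univ_prod_univ, setIntegral_univ] at huniv
      rwa [ih (measure_lt_top _ _), huniv, zero_add] at h
    | iUnion f hd hf ih =>
      rw [integral_iUnion hf hd hint.integrableOn]
      simp [fun i => ih i (measure_lt_top _ _)]
  have hcov : ⋃ n : ℕ × ℕ, spanningSets μ n.1 ×ˢ spanningSets ν n.2 = Set.univ := by
    rw [Set.iUnion_prod, iUnion_spanningSets, iUnion_spanningSets, Set.univ_prod_univ]
  have h := (ae_restrict_iUnion_iff _ _).2 hloc
  rw [hcov, Measure.restrict_univ] at h
  exact (Lp.eq_zero_iff_ae_eq_zero).2 h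

theorem kernelOp_injective :
    Function.Injective (kernelOp : Lp ℂ 2 (μ.prod ν) →L[ℂ] Lp ℂ 2 ν →L[ℂ] Lp ℂ 2 μ) := by
  rw [injective_iff_map_eq_zero]
  intro K hK
  exact eq_zero_of_forall_inner_tensor_eq_zero fun a b => by simp [← inner_kernelOp, hK]

/-- Compact operators are closed in norm, so the kernels with compact operator form a closed
subspace. It contains all tensors (rank one), so its orthogonal complement is zero. -/
theorem isCompactOperator_kernelOp (K : Lp ℂ 2 (μ.prod ν)) : IsCompactOperator (kernelOp K) := by
  set V : Submodule ℂ (Lp ℂ 2 (μ.prod ν)) :=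
    (compactOperator (RingHom.id ℂ) (Lp ℂ 2 ν) (Lp ℂ 2 μ)).comap
      (kernelOp : Lp ℂ 2 (μ.prod ν) →L[ℂ] Lp ℂ 2 ν →L[ℂ] Lp ℂ 2 μ).toLinearMap with hV
  have hclosed : IsClosed (V : Set (Lp ℂ 2 (μ.prod ν))) :=
    (isClosed_setOfPred_isCompactOperator (𝕜₁ := ℂ) (𝕜₂ := ℂ) (σ₁₂ := RingHom.id ℂ)
      (M₁ := Lp ℂ 2 ν) (M₂ := Lp ℂ 2 μ)).preimage kernelOp.continuous
  have hcomplete : CompleteSpace V := hclosed.completeSpace_coe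
  have htensor : ∀ a b, tensor a b ∈ V := by
    intro a b
    change IsCompactOperator (kernelOp (tensor a b))
    rw [funext (kernelOp_tensor a b)]
    exact isCompactOperator_inner_smul a b
  have htop : V = ⊤ := by
    rw [← Submodule.orthogonal_eq_bot_iff, Submodule.eq_bot_iff]
    exact fun K' hK' => eq_zero_of_forall_inner_tensor_eq_zero fun a b => hK' _ (htensor a b)
  have hmem : K ∈ V := htop ▸ Submodule.mem_top
  exact hmem

end Density

end Precoding

namespace Precoding

open scoped InnerProductSpace

/-! ### Inverting a diagonal expansion -/

section HilbertSpace

variable {E F ι : Type*} [NormedAddCommGroup E] [InnerProductSpace ℂ E]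
  [NormedAddCommGroup F] [InnerProductSpace ℂ F]
  {A : E →L[ℂ] F} {σ : ι → ℂ} {f : ι → F} {e : ι → E}

theorem apply_eq_smul_of_hasSum (he : Orthonormal ℂ e)
    (hA : ∀ x, HasSum (fun n => (σ n * ⟪e n, x⟫_ℂ) • f n) (A x)) (n : ι) :
    A (e n) = σ n • f n := by
  classical
  refine (hA (e n)).unique ?_
  have h := hasSum_single (f := fun i => (σ i * ⟪e i, e n⟫_ℂ) • f i) n
    fun i hi => by rw [he.2 hi, mul_zero, zero_smul]
  simpa [he.1 n] using h

/-- The coefficients of `x` are those of `s` divided by `σ n`; applying `A` multiplies them back and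
yields the expansion of `s`. -/
theorem apply_eq_of_hasSum_div_smul [CompleteSpace F] (hσ : ∀ n, σ n ≠ 0) (he : Orthonormal ℂ e)
    (hf : Orthonormal ℂ f) (hA : ∀ x, HasSum (fun n => (σ n * ⟪e n, x⟫_ℂ) • f n) (A x))
    {s : F} (hs : s ∈ (Submodule.span ℂ (Set.range f)).topologicalClosure) {x : E}
    (hx : HasSum (fun n => (⟪f n, s⟫_ℂ / σ n) • e n) x) : A x = s := by
  refine (hA x).unique ?_
  convert hf.hasSum_inner_smul hs using 3 with n
  rw [he.inner_right_hasSum_smul hx n, mul_div_cancel₀ _ (hσ n)]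

/-- Since ⟪f_n, Ay⟫ = σ_n ⟪e_n, y⟫, the quotients are the coefficients of `y` itself, and Bessel
applies. -/
theorem summable_div_smul_of_apply [CompleteSpace E] (hσ : ∀ n, σ n ≠ 0)
    (he : Orthonormal ℂ e) (hf : Orthonormal ℂ f)
    (hA : ∀ x, HasSum (fun n => (σ n * ⟪e n, x⟫_ℂ) • f n) (A x)) (y : E) :
    Summable fun n => (⟪f n, A y⟫_ℂ / σ n) • e n := by
  convert he.summable_inner_smul y using 3 with n
  rw [hf.inner_right_hasSum_smul (hA y) n, mul_div_cancel_left₀ _ (hσ n)]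

/-- `A` sends each partial sum to a partial sum of the expansion of `s`, so the series in `E` need
not converge. -/
theorem tendsto_apply_sum_div_smul [CompleteSpace F] (hσ : ∀ n, σ n ≠ 0) (he : Orthonormal ℂ e)
    (hf : Orthonormal ℂ f) (hA : ∀ x, HasSum (fun n => (σ n * ⟪e n, x⟫_ℂ) • f n) (A x))
    {s : F} (hs : s ∈ (Submodule.span ℂ (Set.range f)).topologicalClosure) :
    Tendsto (fun I : Finset ι => A (∑ n ∈ I, (⟪f n, s⟫_ℂ / σ n) • e n)) atTop (𝓝 s) := by
  have h := hf.hasSum_inner_smul hs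
  rw [HasSum, SummationFilter.unconditional_filter] at h
  convert h using 3 with I
  rw [map_sum]
  refine Finset.sum_congr rfl fun n _ => ?_
  rw [map_smul, apply_eq_smul_of_hasSum he hA, smul_smul, div_mul_cancel₀ _ (hσ n)]

end HilbertSpace

/-! ### Existence of decompositions and the precoding statements -/

section Decomposition

variable {X Y : Type*} [MeasurableSpace X] [MeasurableSpace Y] {μ : Measure X} {ν : Measure Y}

theorem hasSumL2_kernel_iff {ι : Type*} {k : X → Y → ℂ} {σ : ι → ℂ} {ψ : ι → X → ℂ}
    {φ : ι → Y → ℂ} (hk : MemLp (fun z : X × Y => k z.1 z.2) 2 (μ.prod ν))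
    (hψ : ∀ n, MemLp (ψ n) 2 μ) (hφ : ∀ n, MemLp (φ n) 2 ν) :
    HasSumL2 (μ.prod ν) (fun n (z : X × Y) => σ n * ψ n z.1 * φ n z.2) (fun z => k z.1 z.2) ↔
      HasSum (fun n => σ n • tensor ((hψ n).toLp (ψ n)) ((hφ n).conj.toLp _)) (hk.toLp _) := by
  have hfun : (fun n (z : X × Y) => σ n * ψ n z.1 * φ n z.2) =
      fun n => σ n • fun z : X × Y => ψ n z.1 * conj (conj (φ n z.2)) := by
    ext n z
    simp [mul_assoc]
  rw [hfun, hasSumL2_iff (fun n => (memLp_mul_conj (hψ n) (hφ n).conj).const_smul (σ n)) hk]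
  simp only [tensor_toLp]
  rfl

/-- Expansion of a square-integrable kernel in singular vectors of its operator. -/
theorem exists_hasSum_tensor [SigmaFinite μ] [SigmaFinite ν] (K : Lp ℂ 2 (μ.prod ν)) :
    ∃ (I : Set ℕ) (σ : I → ℂ) (f : I → Lp ℂ 2 μ) (e : I → Lp ℂ 2 ν), (∀ n, σ n ≠ 0) ∧
      Orthonormal ℂ f ∧ Orthonormal ℂ e ∧ HasSum (fun n => σ n • tensor (f n) (e n)) K := by
  classical
  obtain ⟨ι, e, he, hne, horth, hker⟩ :=
    (isCompactOperator_kernelOp K).exists_orthonormal_singularVectors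
  set σ : ι → ℂ := fun i => (‖kernelOp K (e i)‖ : ℂ) with hσ_def
  have hσ : ∀ i, σ i ≠ 0 := fun i => by simpa [hσ_def] using hne i
  set f : ι → Lp ℂ 2 μ := fun i => (σ i)⁻¹ • kernelOp K (e i) with hf_def
  have hσf : ∀ i, kernelOp K (e i) = σ i • f i := fun i => by
    rw [hf_def, smul_inv_smul₀ (hσ i)]
  have hf : Orthonormal ℂ f := by
    refine ⟨fun i => ?_, fun i j hij => ?_⟩
    · simp only [hf_def, norm_smul, norm_inv, hσ_def, Complex.norm_real, norm_norm]
      exact inv_mul_cancel₀ (norm_ne_zero_iff.2 (hne i))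
    · simp only [hf_def, inner_smul_left, inner_smul_right, horth i j hij, mul_zero]
  have hg : Orthonormal ℂ fun i => tensor (f i) (e i) := by
    rw [orthonormal_iff_ite]
    intro i j
    rw [inner_tensor_tensor, orthonormal_iff_ite.1 hf, orthonormal_iff_ite.1 he]
    by_cases hij : i = j <;> simp [hij]
  have hcoef : ∀ i, ⟪tensor (f i) (e i), K⟫_ℂ = σ i := fun i => by
    rw [← inner_kernelOp, hσf, inner_smul_right, inner_self_eq_norm_sq_to_K, hf.1 i]
    simp
  -- The squared coefficients of `K` are summable and none is zero, so the index set is countable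
  -- and can be moved into ℕ at the end.
  have hcount : Countable ι := by
    have h := (hg.inner_products_summable K).countable_support
    have hsupp : (Function.support fun i => ‖⟪tensor (f i) (e i), K⟫_ℂ‖ ^ 2) = Set.univ := by
      ext i
      simp [hcoef, hσ i]
    rw [hsupp] at h
    exact Set.countable_univ_iff.1 h
  -- `K'` is the projection of `K` to the closed span of the tensors; comparing operators shows that
  -- nothing is lost.
  obtain ⟨K', hK'⟩ := hg.summable_inner_smul K
  simp only [hcoef] at hK'
  have hop : ∀ x, HasSum (fun i => (σ i * ⟪e i, x⟫_ℂ) • f i) (kernelOp K' x) := fun x => by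
    have h := (hK'.mapL kernelOp).mapL (ContinuousLinearMap.apply ℂ (Lp ℂ 2 μ) x)
    simpa [kernelOp_tensor, smul_smul] using h
  have hKK' : K = K' := by
    refine kernelOp_injective ?_
    refine ContinuousLinearMap.ext_of_forall_orthogonal (v := e) (fun i => ?_) fun x hx => ?_
    · rw [hσf, apply_eq_smul_of_hasSum he hop]
    · rw [hker x hx]
      refine HasSum.unique ?_ (hop x)
      simp only [hx, mul_zero, zero_smul]
      exact hasSum_zero
  obtain ⟨u, hu⟩ := exists_injective_nat ι
  let v := Equiv.ofInjective u hu
  refine ⟨Set.range u, σ ∘ v.symm, f ∘ v.symm, e ∘ v.symm, fun n => hσ _,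
    hf.comp _ v.symm.injective, he.comp _ v.symm.injective, ?_⟩
  rw [← hKK'] at hK'
  exact v.symm.hasSum_iff.2 hK'

theorem exists_isDecomposition [SigmaFinite μ] [SigmaFinite ν] {k : X → Y → ℂ}
    (hk : MemLp (fun z : X × Y => k z.1 z.2) 2 (μ.prod ν)) :
    ∃ (I : Set ℕ) (σ : I → ℂ) (ψ : I → X → ℂ) (φ : I → Y → ℂ),
      IsDecomposition μ ν k σ ψ φ := by
  obtain ⟨I, σ, f, e, hσ, hf, he, hsum⟩ := exists_hasSum_tensor (hk.toLp _)
  -- A decomposition uses φ_n without conjugation, whereas `tensor` conjugates its second factor.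
  refine ⟨I, σ, fun n => f n, fun n q => conj (e n q), hσ, isOrthonormal_coeFn hf,
    (isOrthonormal_coeFn he).conj, ?_⟩
  rw [hasSumL2_kernel_iff hk (fun n => Lp.memLp (f n)) (fun n => (Lp.memLp (e n)).conj)]
  simpa only [Complex.conj_conj, Lp.toLp_coeFn] using hsum

theorem sqNorm_sub_channel [SFinite μ] [SFinite ν] {k : X → Y → ℂ} {s : X → ℂ} {x : Y → ℂ}
    (hk : MemLp (fun z : X × Y => k z.1 z.2) 2 (μ.prod ν)) (hs : MemLp s 2 μ) (hx : MemLp x 2 ν) :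
    sqNorm μ (fun p => s p - channel ν k x p) =
      ‖hs.toLp s - kernelOp (hk.toLp _) (hx.toLp x)‖ₑ ^ 2 := by
  rw [kernelOp_toLp, ← MemLp.toLp_sub, Lp.enorm_toLp, ← sqNorm_eq_eLpNorm_sq]
  rfl

theorem sqNorm_sub_channel_eq_zero_iff [SFinite μ] [SFinite ν] {k : X → Y → ℂ} {s : X → ℂ}
    {x : Y → ℂ}
    (hk : MemLp (fun z : X × Y => k z.1 z.2) 2 (μ.prod ν)) (hs : MemLp s 2 μ) (hx : MemLp x 2 ν) :
    sqNorm μ (fun p => s p - channel ν k x p) = 0 ↔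
      kernelOp (hk.toLp _) (hx.toLp x) = hs.toLp s := by
  rw [sqNorm_sub_channel hk hs hx, pow_eq_zero_iff two_ne_zero, enorm_eq_zero, sub_eq_zero,
    eq_comm]

namespace IsDecomposition

variable {ι : Type*} {k : X → Y → ℂ} {σ : ι → ℂ} {ψ : ι → X → ℂ} {φ : ι → Y → ℂ}

theorem memLp_precodedTerm (d : IsDecomposition μ ν k σ ψ φ) (s : X → ℂ) (n : ι) :
    MemLp (precodedTerm μ σ ψ φ s n) 2 ν :=
  (d.orthonormal_in.conj.memLp n).const_mul _

theorem toLp_precodedTerm (d : IsDecomposition μ ν k σ ψ φ) {s : X → ℂ} (hs : MemLp s 2 μ)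
    (n : ι) : (d.memLp_precodedTerm s n).toLp _ =
      (⟪(d.orthonormal_out.memLp n).toLp (ψ n), hs.toLp s⟫_ℂ / σ n) •
        (d.orthonormal_in.conj.memLp n).toLp _ := by
  rw [← ip_eq_inner hs (d.orthonormal_out.memLp n), ← MemLp.toLp_const_smul]
  rfl

theorem isPrecoded_iff (d : IsDecomposition μ ν k σ ψ φ) {s : X → ℂ} (hs : MemLp s 2 μ)
    {x : Y → ℂ} (hx : MemLp x 2 ν) :
    IsPrecoded μ ν σ ψ φ s x ↔
      HasSum (fun n => (⟪(d.orthonormal_out.memLp n).toLp (ψ n), hs.toLp s⟫_ℂ / σ n) •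
        (d.orthonormal_in.conj.memLp n).toLp _) (hx.toLp x) := by
  simp only [← d.toLp_precodedTerm hs]
  rw [← hasSumL2_iff (d.memLp_precodedTerm s) hx]
  exact ⟨fun h => h.hasSum, fun h => ⟨hx, h⟩⟩

variable [SFinite μ] [SFinite ν]

theorem hasSum_kernelOp (d : IsDecomposition μ ν k σ ψ φ)
    (hk : MemLp (fun z : X × Y => k z.1 z.2) 2 (μ.prod ν)) (x : Lp ℂ 2 ν) :
    HasSum (fun n => (σ n * ⟪(d.orthonormal_in.conj.memLp n).toLp _, x⟫_ℂ) •
      (d.orthonormal_out.memLp n).toLp (ψ n)) (kernelOp (hk.toLp _) x) := by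
  have h := (hasSumL2_kernel_iff hk d.orthonormal_out.memLp d.orthonormal_in.memLp).1 d.hasSum
  have h' := (h.mapL kernelOp).mapL (ContinuousLinearMap.apply ℂ (Lp ℂ 2 μ) x)
  simpa [kernelOp_tensor, smul_smul] using h'

theorem sqNorm_sub_channel_eq_zero (d : IsDecomposition μ ν k σ ψ φ)
    (hk : MemLp (fun z : X × Y => k z.1 z.2) 2 (μ.prod ν)) {s : X → ℂ} (hs : MemLp s 2 μ)
    (hspan : InClosedSpan μ ψ s) {x : Y → ℂ} (hx : IsPrecoded μ ν σ ψ φ s x) :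
    sqNorm μ (fun p => s p - channel ν k x p) = 0 := by
  rw [sqNorm_sub_channel_eq_zero_iff hk hs hx.memLp]
  exact apply_eq_of_hasSum_div_smul d.ne_zero (orthonormal_toLp d.orthonormal_in.conj)
    (orthonormal_toLp d.orthonormal_out) (d.hasSum_kernelOp hk)
    ((inClosedSpan_iff d.orthonormal_out.memLp hs).1 hspan) ((d.isPrecoded_iff hs hx.memLp).1 hx)

theorem exists_sqNorm_sub_channel_eq_zero_iff (d : IsDecomposition μ ν k σ ψ φ)
    (hk : MemLp (fun z : X × Y => k z.1 z.2) 2 (μ.prod ν)) {s : X → ℂ} (hs : MemLp s 2 μ) :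
    (∃ y : Y → ℂ, MemLp y 2 ν ∧ sqNorm μ (fun p => s p - channel ν k y p) = 0) ↔
      InClosedSpan μ ψ s ∧ ∃ x : Y → ℂ, IsPrecoded μ ν σ ψ φ s x := by
  constructor
  · rintro ⟨y, hy, h0⟩
    rw [sqNorm_sub_channel_eq_zero_iff hk hs hy] at h0
    refine ⟨(inClosedSpan_iff d.orthonormal_out.memLp hs).2 ?_, ?_⟩
    · rw [← h0]
      exact (d.hasSum_kernelOp hk _).mem_topologicalClosure_span
    · obtain ⟨x, hx⟩ := summable_div_smul_of_apply d.ne_zero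
        (orthonormal_toLp d.orthonormal_in.conj) (orthonormal_toLp d.orthonormal_out)
        (d.hasSum_kernelOp hk) (hy.toLp y)
      refine ⟨x, (d.isPrecoded_iff hs (Lp.memLp x)).2 ?_⟩
      rwa [Lp.toLp_coeFn, ← h0]
  · rintro ⟨hspan, x, hx⟩
    exact ⟨x, hx.memLp, d.sqNorm_sub_channel_eq_zero hk hs hspan hx⟩

theorem tendsto_sqNorm_sub_channel_sum (d : IsDecomposition μ ν k σ ψ φ)
    (hk : MemLp (fun z : X × Y => k z.1 z.2) 2 (μ.prod ν)) {s : X → ℂ} (hs : MemLp s 2 μ)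
    (hspan : InClosedSpan μ ψ s) :
    Tendsto (fun F : Finset ι => sqNorm μ (fun p => s p -
      channel ν k (fun q => ∑ n ∈ F, precodedTerm μ σ ψ φ s n q) p)) atTop (𝓝 0) := by
  have hmem : ∀ F : Finset ι, MemLp (fun q => ∑ n ∈ F, precodedTerm μ σ ψ φ s n q) 2 ν :=
    fun F => memLp_finsetSum F fun n _ => d.memLp_precodedTerm s n
  have hsum : ∀ F : Finset ι, (hmem F).toLp _ =
      ∑ n ∈ F, (⟪(d.orthonormal_out.memLp n).toLp (ψ n), hs.toLp s⟫_ℂ / σ n) •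
        (d.orthonormal_in.conj.memLp n).toLp _ := by
    intro F
    simp only [← d.toLp_precodedTerm hs]
    have h := coeFn_sub_sum (d.memLp_precodedTerm s) (hmem F) F
    simp only [sub_self] at h
    exact sub_eq_zero.1 ((Lp.eq_zero_iff_ae_eq_zero).2 h)
  simp only [fun F => sqNorm_sub_channel hk hs (hmem F), hsum]
  rw [tendsto_enorm_sq_zero_iff]
  have h := tendsto_apply_sum_div_smul d.ne_zero (orthonormal_toLp d.orthonormal_in.conj)
    (orthonormal_toLp d.orthonormal_out) (d.hasSum_kernelOp hk)
    ((inClosedSpan_iff d.orthonormal_out.memLp hs).1 hspan)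
  simpa using h.const_sub (hs.toLp s)

end IsDecomposition

end Decomposition

end Precoding

theorem theorem2
    {U T U' T' : Type*} [MeasurableSpace U] [MeasurableSpace T]
    [MeasurableSpace U'] [MeasurableSpace T']
    (μU : Measure U) (μT : Measure T) (νU : Measure U') (νT : Measure T')
    [SigmaFinite μU] [SigmaFinite μT] [SigmaFinite νU] [SigmaFinite νT]
    (k : U × T → U' × T' → ℂ)
    (hk : MemLp (fun z : (U × T) × (U' × T') => k z.1 z.2) 2
      ((μU.prod μT).prod (νU.prod νT))) :
    -- the kernel has a decomposition (`I` is finite if the kernel has finite rank)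
    (∃ (I : Set ℕ) (σ : I → ℂ) (ψ : I → U × T → ℂ) (φ : I → U' × T' → ℂ),
      Precoding.IsDecomposition (μU.prod μT) (νU.prod νT) k σ ψ φ) ∧
    -- and every decomposition yields an interference-free precoding
    ∀ (I : Set ℕ) (σ : I → ℂ) (ψ : I → U × T → ℂ) (φ : I → U' × T' → ℂ),
      Precoding.IsDecomposition (μU.prod μT) (νU.prod νT) k σ ψ φ →
      ∀ s : U × T → ℂ, MemLp s 2 (μU.prod μT) →
        -- the precoded signal gives interference-free reception
        (Precoding.InClosedSpan (μU.prod μT) ψ s →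
          ∀ x : U' × T' → ℂ,
            Precoding.IsPrecoded (μU.prod μT) (νU.prod νT) σ ψ φ s x →
            (∀ᵐ p ∂(μU.prod μT), Integrable (fun q => k p q * x q) (νU.prod νT)) ∧
            Precoding.sqNorm (μU.prod μT)
              (fun p => s p - Precoding.channel (νU.prod νT) k x p) = 0) ∧
        -- it exists whenever any transmit signal of finite energy is received without error
        ((∃ y : U' × T' → ℂ, MemLp y 2 (νU.prod νT) ∧
            Precoding.sqNorm (μU.prod μT)
              (fun p => s p - Precoding.channel (νU.prod νT) k y p) = 0) ↔
          Precoding.InClosedSpan (μU.prod μT) ψ s ∧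
            ∃ x : U' × T' → ℂ,
              Precoding.IsPrecoded (μU.prod μT) (νU.prod νT) σ ψ φ s x) ∧
        -- and in any case the error of its partial sums tends to zero
        (Precoding.InClosedSpan (μU.prod μT) ψ s →
          Tendsto (fun F : Finset I =>
            Precoding.sqNorm (μU.prod μT) (fun p => s p -
              Precoding.channel (νU.prod νT) k
                (fun q => ∑ n ∈ F, Precoding.precodedTerm (μU.prod μT) σ ψ φ s n q) p))
            atTop (𝓝 0)) := by
  refine ⟨Precoding.exists_isDecomposition hk, fun I σ ψ φ d s hs => ⟨fun hspan x hx => ?_,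
    d.exists_sqNorm_sub_channel_eq_zero_iff hk hs, d.tendsto_sqNorm_sub_channel_sum hk hs⟩⟩
  exact ⟨Precoding.ae_integrable_kernel_mul hk hx.memLp,
    d.sqNorm_sub_channel_eq_zero hk hs hspan hx⟩
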